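/- **Hub model with a null component.** Let $0\le n_L\le n$ and $T$ be integers. The nodes are $1,\dots,n$, and the nodes $1,\dots,n_L$ are the leaders. The parameters are a probability vector $\rho=(\rho_0,\dots,\rho_{n_L})$ and a matrix $A=(A_{ij})_{0\le i\le n_L,\,1\le j\le n}$ with entries in $[0,1]$ and $A_{ii}=1$ for $1\le i\le n_L$ (row $0$ is the null component). One observes $T$ independent groups $G^{(t)}\in\{0,1\}^n$: a latent label $z_*^{(t)}\in\{0,\dots,n_L\}$ is drawn with $\mathbb P(z_*^{(t)}=i)=\rho_i$ and, given $z_*^{(t)}=i$, the coordinates of $G^{(t)}$ are independent with $\mathbb P(G^{(t)}_j=1\mid z_*^{(t)}=i)=A_{ij}$. For a label assignment $z\in\{0,\dots,n_L\}^T$ let $$L_G(A'\mid z)=\sum_{t=1}^T\sum_{j=1}^n\Big[G_j^{(t)}\log A'_{z^{(t)}j}+(1-G_j^{(t)})\log(1-A'_{z^{(t)}j})\Big],\qquad L_G(z)=\max_{A'}L_G(A'\mid z)$$ (with $\log 0=-\infty$, $0\log 0=0$), where $A'$ ranges over all matrices with entries in $[0,1]$ and $A'_{ii}=1$ for $1\le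 i\le n_L$; let $\hat z$ be any maximizer of $L_G(z)$ over $z$, and $T_e=\#\{t: z_*^{(t)}\ne\hat z^{(t)}\}$. Consider a sequence of such models, in which $n_L,n,T,\rho,A$ and the numbers $d,v>0$ below may vary along the sequence. Assume throughout that (i) for each $i=1,\dots,n_L$ there is a set $V_i\subset\{1,\dots,n\}$ with $|V_i|\ge vn/n_L$ and $A_{ij}-A_{i'j}\ge d$ for all $j\in V_i$ and all $i'\in\{0,\dots,n_L\}$, $i'\ne i$. **Theorem 9.** Suppose also that there are positive constants $c_{\min},c_{\max},c_0$ such that $c_{\min}/n_L\le\rho_i\le c_{\max}/n_L$ for $i=0,\dots,n_L$, and (ii) $A_{ii'}\le c_0/n_L$ for $i=0,\dots,n_L$, $i'=1,\dots,n_L$, $i\ne i'$. If $n_L\to\infty$, $n\to\infty$, $T\to\infty$ and $$\frac{n_L^2\log n_L}{T}=o(1),\qquad \frac{n_L^5\log T}{d^2vT}=o(1),\qquad \frac{n_L^8\log n_L}{d^4v^2n}=o(1),$$ then $T_e/T=o_p(1)$, i.e. $\mathbb P(T_e/T\ge\varepsilon)\to0$ for every $\varepsilon>0$. **Theorem 9′.**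 Suppose instead that $n_L$ is fixed and that there are constants $c_{\min}>0$ and $b<1$ such that $\rho_i\ge c_{\min}$ for $i=0,\dots,n_L$, and (ii′) $A_{ii'}\le b$ for $i=0,\dots,n_L$, $i'=1,\dots,n_L$, $i\ne i'$. If $n\to\infty$, $T\to\infty$, $(\log T)/(d^2vT)=o(1)$ and $d^4v^2n\to\infty$, then $T_e/T=o_p(1)$. -/

import Mathlib

open MeasureTheory Filter Topology
open scoped ENNReal

noncomputable section

namespace HubNull

/-- The admissible connection matrices with rows `0, ..., nL` and columns indexed by the `n` nodes.
Row `0` is the null component (`A 0 j = π_j`), row `i.succ` belongs to leader `i`; the leaders are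
the first `nL` nodes, leader `i` being the node `Fin.castLE hn i`.  Entries lie in `[0, 1]`, and a
leader belongs to every group of which it is the hub. -/
structure IsConnMatrix {nL n : ℕ} (hn : nL ≤ n) (A : Fin (nL + 1) → Fin n → ℝ) : Prop where
  nonneg : ∀ i j, 0 ≤ A i j
  le_one : ∀ i j, A i j ≤ 1
  diag : ∀ i : Fin nL, A i.succ (Fin.castLE hn i) = 1

/-- Parameters `(ρ, A)` of the hub model with a null component. -/
structure Params {nL n : ℕ} (hn : nL ≤ n) where
  /-- hub probabilities `ρ_0, ..., ρ_{nL}` -/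
  ρ : Fin (nL + 1) → ℝ
  /-- connection matrix, with row `0` equal to `π` -/
  A : Fin (nL + 1) → Fin n → ℝ
  ρ_nonneg : ∀ i, 0 ≤ ρ i
  ρ_sum : ∑ i, ρ i = 1
  conn : IsConnMatrix hn A

/-- The Bernoulli law on `Bool` with success probability `p`. -/
def bern (p : ℝ) : Measure Bool :=
  ENNReal.ofReal p • Measure.dirac true + ENNReal.ofReal (1 - p) • Measure.dirac false

/-- The joint law of the hub label and the group for a single observation: the label `i` has
probability `ρ i`, and given `i` the nodes appear independently, node `j` with probability
`A i j`. -/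
def groupLaw {nL n : ℕ} {hn : nL ≤ n} (θ : Params hn) :
    Measure (Fin (nL + 1) × (Fin n → Bool)) :=
  ∑ i, ENNReal.ofReal (θ.ρ i) •
    (Measure.dirac i).prod (Measure.pi fun j => bern (θ.A i j))

/-- Outcomes of `T` observations: true hub labels together with the groups. -/
abbrev Sample (nL n T : ℕ) := Fin T → Fin (nL + 1) × (Fin n → Bool)

/-- The law of `T` independent observations. -/
def sampleLaw {nL n : ℕ} {hn : nL ≤ n} (θ : Params hn) (T : ℕ) : Measure (Sample nL n T) :=
  Measure.pi fun _ => groupLaw θ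

/-- The true labels `z_*`. -/
def trueLabels {nL n T : ℕ} (ω : Sample nL n T) : Fin T → Fin (nL + 1) := fun t => (ω t).1

/-- The observed groups `G`. -/
def groups {nL n T : ℕ} (ω : Sample nL n T) : Fin T → Fin n → Bool := fun t => (ω t).2

/-- The logarithm of a nonnegative real number, with `log 0 = -∞`. -/
def elog (x : ℝ) : EReal := ENNReal.log (ENNReal.ofReal x)

/-- The log-likelihood `L_G(A | z)`, where `0 * log 0 = 0` and `log 0 = -∞`. -/
def logLik {nL n T : ℕ} (G : Fin T → Fin n → Bool) (z : Fin T → Fin (nL + 1))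
    (A : Fin (nL + 1) → Fin n → ℝ) : EReal :=
  ∑ t, ∑ j, if G t j then elog (A (z t) j) else elog (1 - A (z t) j)

/-- The profile log-likelihood `L_G(z)`: the maximum of `L_G(A | z)` over all admissible connection
matrices.  It is `-∞` when some group is assigned a leader that does not appear in it. -/
def profileLogLik {nL n T : ℕ} (hn : nL ≤ n) (G : Fin T → Fin n → Bool)
    (z : Fin T → Fin (nL + 1)) : EReal :=
  ⨆ (A : Fin (nL + 1) → Fin n → ℝ) (_ : IsConnMatrix hn A), logLik G z A

/-- `z` maximizes the profile log-likelihood over all label assignments. -/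
def IsMaxProfile {nL n T : ℕ} (hn : nL ≤ n) (G : Fin T → Fin n → Bool)
    (z : Fin T → Fin (nL + 1)) : Prop :=
  ∀ z' : Fin T → Fin (nL + 1), profileLogLik hn G z' ≤ profileLogLik hn G z

/-- `T_e / T`, the fraction of groups whose label is wrong. -/
def errorRate {nL T : ℕ} (zs z : Fin T → Fin (nL + 1)) : ℝ :=
  ((Finset.univ.filter fun t => zs t ≠ z t).card : ℝ) / (T : ℝ)

/-- Separation: for each leader `i` there is a set `V` of at least `v n / nL` nodes that are more
likely, by at least `d`, to join a group of hub `i` than a group with any other label, including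
the null label `0`. -/
def Separated {nL n : ℕ} (A : Fin (nL + 1) → Fin n → ℝ) (d v : ℝ) : Prop :=
  ∀ i : Fin nL, ∃ V : Finset (Fin n), v * (n : ℝ) / (nL : ℝ) ≤ (V.card : ℝ) ∧
    ∀ j ∈ V, ∀ k : Fin (nL + 1), k ≠ i.succ → d ≤ A i.succ j - A k j

/-- Every leader joins groups with another label (or with the null label) with probability at
most `b`. -/
def LeaderBound {nL n : ℕ} (hn : nL ≤ n) (A : Fin (nL + 1) → Fin n → ℝ) (b : ℝ) : Prop :=
  ∀ (k : Fin (nL + 1)) (i : Fin nL), k ≠ i.succ → A k (Fin.castLE hn i) ≤ b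

end HubNull

end

/-!
The maximality of `ẑ` makes the likelihood of the groups at `ẑ`, with its empirical connection
matrix, at least their likelihood under the true labels and parameters. Given the true labels, the
square root of the likelihood ratio of fixed alternative probabilities `Q` to the true ones `A` has
mean at most `exp (-D / 2)`, where `D` is the squared distance between them. There are
`(nL + 1) ^ T` label assignments, and for each of them at most `(T + 1) ^ ((nL + 1) * n)` empirical
matrices, so by a union bound the empirical matrix of `ẑ` is close to `A` with high probability.
Since the rows of `A` are separated, `ẑ` then determines `z_*` up to a relabelling `σ` and few
errors.

A positive likelihood means that every group labelled with a leader contains that leader. If `σ`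
sends `k` to `i ≠ k`, the class `k` therefore consists, up to few errors, of groups of hub `i`
containing the leader `k`. By Chebyshev's inequality there are few such groups in total when the
label probabilities tend to `0`, and they are only a proper part of the groups of hub `i` when those
probabilities are bounded below, in which case `σ` has to be the identity.
-/

namespace HubNull

section Frequency

variable {τ : Type*} [Fintype τ]

open Classical in
/-- The fraction of the indices with the property `p`; it is `0` when there are no indices. -/
noncomputable def freq (p : τ → Prop) : ℝ :=
  ((Finset.univ.filter p).card : ℝ) / (Fintype.card τ : ℝ)

lemma freq_nonneg (p : τ → Prop) : 0 ≤ freq p := by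
  unfold freq; positivity

lemma freq_mono {p q : τ → Prop} (h : ∀ t, p t → q t) : freq p ≤ freq q := by
  unfold freq
  gcongr with t
  exact h t

lemma freq_exists_le {ι : Type*} [Fintype ι] (p : ι → τ → Prop) :
    freq (fun t => ∃ i, p i t) ≤ ∑ i, freq (p i) := by
  classical
  unfold freq
  rw [← Finset.sum_div]
  gcongr
  refine le_trans (Nat.cast_le.mpr (Finset.card_le_card fun t ht => ?_))
    (mod_cast Finset.card_biUnion_le (s := Finset.univ) (t := fun i => Finset.univ.filter (p i)))
  simpa using ht

lemma freq_or_le (p q : τ → Prop) : freq (fun t => p t ∨ q t) ≤ freq p + freq q := by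
  classical
  unfold freq
  rw [← add_div]
  gcongr
  refine le_trans (Nat.cast_le.mpr (Finset.card_le_card fun t ht => ?_))
    (mod_cast Finset.card_union_le (Finset.univ.filter p) (Finset.univ.filter q))
  simpa using ht

lemma errorRate_eq_freq {nL T : ℕ} (zs z : Fin T → Fin (nL + 1)) :
    errorRate zs z = freq fun t => zs t ≠ z t := by
  simp only [errorRate, freq, Fintype.card_fin]
  congr!

end Frequency

section Product

variable {τ α : Type*} [Fintype τ]

lemma freq_mem_eq_sum_indicator (E : Set α) :
    (fun ω : τ → α => freq fun t => ω t ∈ E) =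
      ∑ t, fun ω : τ → α => E.indicator (fun _ => (Fintype.card τ : ℝ)⁻¹) (ω t) := by
  classical
  ext ω
  simp [freq, Set.indicator_apply, Finset.sum_ite, div_eq_mul_inv]

variable [MeasurableSpace α] (μ : Measure α) [IsProbabilityMeasure μ] {E : Set α}

lemma memLp_indicator_const (hE : MeasurableSet E) (c : ℝ) : MemLp (E.indicator fun _ => c) 2 μ :=
  (memLp_const c).indicator hE

lemma memLp_freq_mem (hE : MeasurableSet E) :
    MemLp (fun ω : τ → α => freq fun t => ω t ∈ E) 2 (Measure.pi fun _ => μ) := by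
  rw [freq_mem_eq_sum_indicator]
  exact memLp_finsetSum' _ fun t _ =>
    (memLp_indicator_const μ hE _).comp_measurePreserving (measurePreserving_eval _ t)

lemma integral_freq_mem [Nonempty τ] (hE : MeasurableSet E) :
    ∫ ω : τ → α, freq (fun t => ω t ∈ E) ∂Measure.pi (fun _ => μ) = μ.real E := by
  set X : α → ℝ := E.indicator fun _ => (Fintype.card τ : ℝ)⁻¹
  have hX : MemLp X 2 μ := memLp_indicator_const μ hE _
  have hmean (t : τ) :
      ∫ ω : τ → α, X (ω t) ∂Measure.pi (fun _ => μ) = μ.real E * (Fintype.card τ : ℝ)⁻¹ :=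
    (integral_comp_eval (μ := fun _ : τ => μ) hX.aestronglyMeasurable).trans
      (integral_indicator_const _ hE)
  calc ∫ ω : τ → α, freq (fun t => ω t ∈ E) ∂Measure.pi (fun _ => μ)
      = ∑ t, ∫ ω : τ → α, X (ω t) ∂Measure.pi (fun _ => μ) := by
        rw [freq_mem_eq_sum_indicator, Finset.sum_fn]
        exact integral_finsetSum _ fun t _ => integrable_comp_eval (hX.integrable one_le_two)
    _ = μ.real E := by
        rw [Finset.sum_congr rfl fun t _ => hmean t, Finset.sum_const, Finset.card_univ,
          nsmul_eq_mul]
        field_simp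

lemma variance_freq_mem_le [Nonempty τ] (hE : MeasurableSet E) :
    ProbabilityTheory.variance (fun ω : τ → α => freq fun t => ω t ∈ E) (Measure.pi fun _ => μ) ≤
      μ.real E / Fintype.card τ := by
  set X : α → ℝ := E.indicator fun _ => (Fintype.card τ : ℝ)⁻¹
  have hX : MemLp X 2 μ := memLp_indicator_const μ hE _
  have hsq : X ^ 2 = E.indicator fun _ => (Fintype.card τ : ℝ)⁻¹ ^ 2 := by
    ext x
    by_cases hx : x ∈ E <;> simp [X, hx]
  have hvar : ProbabilityTheory.variance X μ ≤ μ.real E * (Fintype.card τ : ℝ)⁻¹ ^ 2 := by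
    refine (ProbabilityTheory.variance_le_expectation_sq hX.aestronglyMeasurable).trans_eq ?_
    rw [hsq, integral_indicator_const _ hE, smul_eq_mul]
  rw [freq_mem_eq_sum_indicator,
    ProbabilityTheory.variance_sum_pi (μ := fun _ : τ => μ) (X := fun _ => X) fun _ => hX]
  calc ∑ _t : τ, ProbabilityTheory.variance X μ
      ≤ ∑ _t : τ, μ.real E * (Fintype.card τ : ℝ)⁻¹ ^ 2 := Finset.sum_le_sum fun _ _ => hvar
    _ = μ.real E / Fintype.card τ := by
      rw [Finset.sum_const, Finset.card_univ, nsmul_eq_mul]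
      field_simp

lemma pi_freq_deviation_le [Nonempty τ] (hE : MeasurableSet E) {s : ℝ} (hs : 0 < s) :
    Measure.pi (fun _ : τ => μ) {ω | s ≤ |freq (fun t => ω t ∈ E) - μ.real E|} ≤
      ENNReal.ofReal (μ.real E / (Fintype.card τ * s ^ 2)) := by
  have hcheb := ProbabilityTheory.meas_ge_le_variance_div_sq (memLp_freq_mem (τ := τ) μ hE) hs
  rw [integral_freq_mem μ hE] at hcheb
  refine hcheb.trans (ENNReal.ofReal_le_ofReal ?_)
  rw [← div_div]
  gcongr
  exact variance_freq_mem_le μ hE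

lemma pi_exists_freq_deviation_le {ι : Type*} [Fintype ι] [Nonempty τ] {E : ι → Set α}
    (hE : ∀ i, MeasurableSet (E i)) {s : ℝ} (hs : 0 < s) :
    Measure.pi (fun _ : τ => μ) {ω | ∃ i, s ≤ |freq (fun t => ω t ∈ E i) - μ.real (E i)|} ≤
      ENNReal.ofReal ((∑ i, μ.real (E i)) / (Fintype.card τ * s ^ 2)) := by
  rw [Set.ofPred_exists, Finset.sum_div, ENNReal.ofReal_sum_of_nonneg fun i _ => by positivity]
  exact (measure_iUnion_fintype_le _ _).trans
    (Finset.sum_le_sum fun i _ => pi_freq_deviation_le μ (hE i) hs)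

end Product

section ProductOfFunctions

variable {ι : Type*} [Fintype ι] {α : ι → Type*} [∀ i, MeasurableSpace (α i)]
  (μ : ∀ i, Measure (α i)) [∀ i, IsProbabilityMeasure (μ i)] {f : ∀ i, α i → ℝ≥0∞}

lemma lintegral_pi_prod (hf : ∀ i, Measurable (f i)) :
    ∫⁻ x, ∏ i, f i (x i) ∂Measure.pi μ = ∏ i, ∫⁻ a, f i a ∂μ i := by
  rw [ProbabilityTheory.lintegral_prod_eq_prod_lintegral_of_indepFun Finset.univ
    (fun i (x : ∀ i, α i) => f i (x i))
    (ProbabilityTheory.iIndepFun_pi fun i => (hf i).aemeasurable)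
    fun i => (hf i).comp (measurable_pi_apply i)]
  exact Finset.prod_congr rfl fun i _ => (measurePreserving_eval μ i).lintegral_comp (hf i)

lemma pi_le_prod_le_inv (hf : ∀ i, Measurable (f i)) (hint : ∀ i, ∫⁻ a, f i a ∂μ i ≤ 1)
    {c : ℝ≥0∞} (hc₀ : c ≠ 0) (hc : c ≠ ∞) : Measure.pi μ {x | c ≤ ∏ i, f i (x i)} ≤ c⁻¹ := by
  have hprod : Measurable fun x : ∀ i, α i => ∏ i, f i (x i) :=
    Finset.measurable_fun_prod _ fun i _ => (hf i).comp (measurable_pi_apply i)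
  refine (meas_ge_le_lintegral_div hprod.aemeasurable hc₀ hc).trans ?_
  rw [lintegral_pi_prod μ hf, ← one_div]
  gcongr
  exact Finset.prod_le_one' fun i _ => hint i

end ProductOfFunctions

section Bernoulli

@[simp] lemma bern_true (p : ℝ) : bern p {true} = ENNReal.ofReal p := by simp [bern]

@[simp] lemma bern_false (p : ℝ) : bern p {false} = ENNReal.ofReal (1 - p) := by simp [bern]

lemma bern_singleton_ne_top (p : ℝ) (b : Bool) : bern p {b} ≠ ∞ := by cases b <;> simp

lemma isProbabilityMeasure_bern {p : ℝ} (h₀ : 0 ≤ p) (h₁ : p ≤ 1) :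
    IsProbabilityMeasure (bern p) := by
  constructor
  simp only [bern, Measure.coe_add, Measure.coe_smul, Pi.add_apply, Pi.smul_apply, measure_univ,
    smul_eq_mul, mul_one]
  rw [← ENNReal.ofReal_add h₀ (by linarith), add_sub_cancel, ENNReal.ofReal_one]

lemma bern_affinity_le {p q : ℝ} (hp₀ : 0 ≤ p) (hp₁ : p ≤ 1) (hq₀ : 0 ≤ q) (hq₁ : q ≤ 1) :
    √p * √q + √(1 - p) * √(1 - q) ≤ Real.exp (-((p - q) ^ 2 / 2)) := by
  have hp' : 0 ≤ 1 - p := by linarith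
  have hq' : 0 ≤ 1 - q := by linarith
  have amgm : 2 * (√p * √q * (√(1 - p) * √(1 - q))) ≤ p * (1 - p) + q * (1 - q) := by
    have h := two_mul_le_add_sq (√p * √(1 - p)) (√q * √(1 - q))
    simp only [mul_pow, Real.sq_sqrt, hp₀, hp', hq₀, hq'] at h
    linarith
  have hsq : (√p * √q + √(1 - p) * √(1 - q)) ^ 2 ≤ 1 - (p - q) ^ 2 := by
    simp only [add_sq, mul_pow, Real.sq_sqrt, hp₀, hp', hq₀, hq']
    nlinarith
  refine (Real.le_sqrt_of_sq_le hsq).trans (Real.sqrt_le_iff.mpr ⟨(Real.exp_pos _).le, ?_⟩)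
  rw [← Real.exp_nat_mul]
  convert Real.add_one_le_exp (-(p - q) ^ 2) using 1 <;> [ring; (congr 1; push_cast; ring)]

/-- The square root of the likelihood ratio of `bern q` to `bern p`, multiplied by the factor
`exp ((p - q) ^ 2 / 2)`, with which its mean under `bern p` is still at most `1`. -/
noncomputable def tiltedRatio (p q : ℝ) (b : Bool) : ℝ≥0∞ :=
  ENNReal.ofReal (Real.exp ((p - q) ^ 2 / 2)) * (bern q {b} / bern p {b}) ^ (1 / 2 : ℝ)

lemma rpow_half_div_mul_le (x y : ℝ≥0∞) :
    (y / x) ^ (1 / 2 : ℝ) * x ≤ x ^ (1 / 2 : ℝ) * y ^ (1 / 2 : ℝ) := by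
  have hx : x = x ^ (1 / 2 : ℝ) * x ^ (1 / 2 : ℝ) := by
    rw [← ENNReal.mul_rpow_of_nonneg _ _ (by norm_num), ← sq, ← ENNReal.rpow_natCast_mul]
    norm_num
  calc (y / x) ^ (1 / 2 : ℝ) * x
      = (y / x * x) ^ (1 / 2 : ℝ) * x ^ (1 / 2 : ℝ) := by
        rw [ENNReal.mul_rpow_of_nonneg _ _ (by norm_num), mul_assoc, ← hx]
    _ ≤ x ^ (1 / 2 : ℝ) * y ^ (1 / 2 : ℝ) := by
        rw [mul_comm, mul_comm (y / x)]
        gcongr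
        exact ENNReal.mul_div_le

lemma lintegral_tiltedRatio_le_one {p q : ℝ} (hp₀ : 0 ≤ p) (hp₁ : p ≤ 1) (hq₀ : 0 ≤ q)
    (hq₁ : q ≤ 1) : ∫⁻ b, tiltedRatio p q b ∂bern p ≤ 1 := by
  have hsqrt {x : ℝ} (hx : 0 ≤ x) : ENNReal.ofReal x ^ (1 / 2 : ℝ) = ENNReal.ofReal √x := by
    rw [ENNReal.ofReal_rpow_of_nonneg hx (by norm_num), Real.sqrt_eq_rpow]
  have hmul {x y : ℝ} (hx : 0 ≤ x) (hy : 0 ≤ y) :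
      (ENNReal.ofReal y / ENNReal.ofReal x) ^ (1 / 2 : ℝ) * ENNReal.ofReal x ≤
        ENNReal.ofReal (√x * √y) := by
    rw [ENNReal.ofReal_mul (Real.sqrt_nonneg x), ← hsqrt hx, ← hsqrt hy]
    exact rpow_half_div_mul_le _ _
  have hp' : 0 ≤ 1 - p := by linarith
  have hq' : 0 ≤ 1 - q := by linarith
  simp only [tiltedRatio, lintegral_fintype, Fintype.sum_bool, bern_true, bern_false, mul_assoc,
    ← mul_add]
  calc _ ≤ ENNReal.ofReal (Real.exp ((p - q) ^ 2 / 2)) *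
        (ENNReal.ofReal (√p * √q) + ENNReal.ofReal (√(1 - p) * √(1 - q))) := by
        gcongr
        exacts [hmul hp₀ hq₀, hmul hp' hq']
    _ ≤ ENNReal.ofReal (Real.exp ((p - q) ^ 2 / 2)) *
        ENNReal.ofReal (Real.exp (-((p - q) ^ 2 / 2))) := by
        rw [← ENNReal.ofReal_add (by positivity) (by positivity)]
        gcongr
        exact bern_affinity_le hp₀ hp₁ hq₀ hq₁
    _ = 1 := by
        rw [← ENNReal.ofReal_mul (Real.exp_pos _).le, ← Real.exp_add, add_neg_cancel,
          Real.exp_zero, ENNReal.ofReal_one]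

end Bernoulli

section BinomialLikelihood

lemma pow_le_div_pow_mul_exp {a N : ℝ} (ha : 0 ≤ a) (hN : 0 < N) (m : ℕ) :
    a ^ m ≤ (m / N) ^ m * Real.exp (a * N - m) := by
  rcases m.eq_zero_or_pos with rfl | hm
  · simpa using mul_nonneg ha hN.le
  have hm' : (0 : ℝ) < m := mod_cast hm
  have hle : a * N / m ≤ Real.exp (a * N / m - 1) := by
    linarith [Real.add_one_le_exp (a * N / m - 1)]
  calc a ^ m = (m / N) ^ m * (a * N / m) ^ m := by rw [← mul_pow]; field_simp
    _ ≤ (m / N) ^ m * Real.exp (a * N / m - 1) ^ m := by gcongr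
    _ = (m / N) ^ m * Real.exp (a * N - m) := by
      rw [← Real.exp_nat_mul, mul_sub, mul_div_cancel₀ _ hm'.ne', mul_one]

lemma pow_mul_one_sub_pow_le {a : ℝ} (h₀ : 0 ≤ a) (h₁ : a ≤ 1) (m l : ℕ) :
    a ^ m * (1 - a) ^ l ≤ (m / (m + l : ℝ)) ^ m * (1 - m / (m + l : ℝ)) ^ l := by
  rcases Nat.eq_zero_or_pos (m + l) with h | h
  · obtain ⟨rfl, rfl⟩ : m = 0 ∧ l = 0 := by omega
    simp
  have hN : (0 : ℝ) < m + l := mod_cast h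
  calc a ^ m * (1 - a) ^ l
      ≤ ((m / (m + l : ℝ)) ^ m * Real.exp (a * (m + l) - m)) *
          ((l / (m + l : ℝ)) ^ l * Real.exp ((1 - a) * (m + l) - l)) := by
        have := sub_nonneg.mpr h₁
        gcongr
        exacts [pow_le_div_pow_mul_exp h₀ hN m, pow_le_div_pow_mul_exp (sub_nonneg.mpr h₁) hN l]
    _ = (m / (m + l : ℝ)) ^ m * (l / (m + l : ℝ)) ^ l := by
        have hexp : Real.exp (a * (m + l) - m) * Real.exp ((1 - a) * (m + l) - l) = 1 := by
          rw [← Real.exp_add, Real.exp_eq_one_iff]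
          ring
        rw [mul_mul_mul_comm, hexp, mul_one]
    _ = (m / (m + l : ℝ)) ^ m * (1 - m / (m + l : ℝ)) ^ l := by
        rw [one_sub_div hN.ne', add_sub_cancel_left]

end BinomialLikelihood

section Likelihood

variable {nL n T : ℕ} (G : Fin T → Fin n → Bool) (z : Fin T → Fin (nL + 1))

/-- The likelihood of the groups `G`, given the labels `z`, under the connection matrix `A`. -/
noncomputable def lik (A : Fin (nL + 1) → Fin n → ℝ) : ℝ≥0∞ :=
  ∏ t, ∏ j, bern (A (z t) j) {G t j}

lemma log_prod_ennreal {ι : Type*} (s : Finset ι) (f : ι → ℝ≥0∞) :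
    ENNReal.log (∏ i ∈ s, f i) = ∑ i ∈ s, ENNReal.log (f i) := by
  classical
  induction s using Finset.induction_on with
  | empty => simp
  | insert a s ha ih => rw [Finset.prod_insert ha, Finset.sum_insert ha, ENNReal.log_mul_add, ih]

lemma logLik_eq_log_lik (A : Fin (nL + 1) → Fin n → ℝ) :
    logLik G z A = ENNReal.log (lik G z A) := by
  simp_rw [lik, log_prod_ennreal, logLik, elog]
  refine Finset.sum_congr rfl fun t _ => Finset.sum_congr rfl fun j _ => ?_
  cases G t j <;> simp

lemma lik_eq_prod_class (A : Fin (nL + 1) → Fin n → ℝ) :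
    lik G z A = ∏ j, ∏ k, ∏ t with z t = k, bern (A k j) {G t j} := by
  rw [lik, Finset.prod_comm]
  refine Finset.prod_congr rfl fun j _ => ?_
  rw [← Finset.prod_fiberwise (s := Finset.univ) (g := z)]
  refine Finset.prod_congr rfl fun k _ => Finset.prod_congr rfl fun t ht => ?_
  rw [(Finset.mem_filter.mp ht).2]

lemma prod_bern_singleton {ι : Type*} (s : Finset ι) (g : ι → Bool) {a : ℝ} (h₀ : 0 ≤ a)
    (h₁ : a ≤ 1) :
    ∏ t ∈ s, bern a {g t} = ENNReal.ofReal
      (a ^ (s.filter fun t => g t).card * (1 - a) ^ (s.filter fun t => ¬ g t).card) := by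
  have hbern (b : Bool) :
      bern a {b} = if b then ENNReal.ofReal a else ENNReal.ofReal (1 - a) := by cases b <;> simp
  simp_rw [hbern]
  rw [Finset.prod_ite, Finset.prod_const, Finset.prod_const, ENNReal.ofReal_mul (by positivity),
    ENNReal.ofReal_pow h₀, ENNReal.ofReal_pow (by linarith)]

/-- The maximum likelihood estimate of the connection matrix given the labels `z`: its `(k, j)`
entry is the fraction of the groups labelled `k` that contain the node `j`, and `0` if there are no
groups labelled `k`. -/
noncomputable def empiricalMatrix (k : Fin (nL + 1)) (j : Fin n) : ℝ :=
  ((Finset.univ.filter fun t => z t = k ∧ G t j).card : ℝ) /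
    ((Finset.univ.filter fun t => z t = k).card : ℝ)

lemma empiricalMatrix_nonneg (k : Fin (nL + 1)) (j : Fin n) : 0 ≤ empiricalMatrix G z k j := by
  unfold empiricalMatrix; positivity

lemma empiricalMatrix_le_one (k : Fin (nL + 1)) (j : Fin n) : empiricalMatrix G z k j ≤ 1 := by
  refine div_le_one_of_le₀ ?_ (Nat.cast_nonneg _)
  gcongr
  exact And.left

lemma lik_le_lik_empiricalMatrix {A : Fin (nL + 1) → Fin n → ℝ} (h₀ : ∀ i j, 0 ≤ A i j)
    (h₁ : ∀ i j, A i j ≤ 1) : lik G z A ≤ lik G z (empiricalMatrix G z) := by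
  rw [lik_eq_prod_class, lik_eq_prod_class]
  refine Finset.prod_le_prod' fun j _ => Finset.prod_le_prod' fun k _ => ?_
  have hclass : ((Finset.univ.filter fun t => z t = k).card : ℝ) =
      ((Finset.univ.filter fun t => z t = k).filter fun t => G t j).card +
        ((Finset.univ.filter fun t => z t = k).filter fun t => ¬ G t j).card :=
    mod_cast (Finset.card_filter_add_card_filter_not _).symm
  rw [prod_bern_singleton _ _ (h₀ k j) (h₁ k j), prod_bern_singleton _ _
    (empiricalMatrix_nonneg G z k j) (empiricalMatrix_le_one G z k j), empiricalMatrix,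
    ← Finset.filter_filter, hclass]
  exact ENNReal.ofReal_le_ofReal (pow_mul_one_sub_pow_le (h₀ k j) (h₁ k j) _ _)

open Classical in
lemma card_image_empiricalMatrix_le :
    (Finset.univ.image fun G : Fin T → Fin n → Bool => empiricalMatrix G z).card ≤
      (T + 1) ^ ((nL + 1) * n) := by
  let hits (G : Fin T → Fin n → Bool) (k : Fin (nL + 1)) (j : Fin n) : Fin (T + 1) :=
    ⟨(Finset.univ.filter fun t => z t = k ∧ G t j).card,
      Nat.lt_succ_of_le ((Finset.card_le_univ _).trans_eq (Fintype.card_fin T))⟩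
  let ratio (m : Fin (nL + 1) → Fin n → Fin (T + 1)) (k : Fin (nL + 1)) (j : Fin n) : ℝ :=
    (m k j : ℝ) / ((Finset.univ.filter fun t => z t = k).card : ℝ)
  have hfactor : (fun G => empiricalMatrix G z) = ratio ∘ hits := rfl
  rw [hfactor, ← Finset.image_image]
  refine (Finset.card_image_le.trans (Finset.card_le_univ _)).trans_eq ?_
  simp [← pow_mul, mul_comm]

end Likelihood

section ProfileMaximizer

variable {nL n T : ℕ} {hn : nL ≤ n} {G : Fin T → Fin n → Bool} {z zs : Fin T → Fin (nL + 1)}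
  {A : Fin (nL + 1) → Fin n → ℝ}

/-- The labels `z` assign a group only to leaders that belong to it; equivalently, `z` has positive
likelihood under some connection matrix. -/
def RespectsHubs (hn : nL ≤ n) (G : Fin T → Fin n → Bool) (z : Fin T → Fin (nL + 1)) : Prop :=
  ∀ (t : Fin T) (k : Fin nL), z t = k.succ → G t (Fin.castLE hn k) = true

lemma respectsHubs_of_lik_ne_zero (hA : IsConnMatrix hn A) (h : lik G z A ≠ 0) :
    RespectsHubs hn G z := by
  intro t k hk
  by_contra hG
  refine h (Finset.prod_eq_zero (Finset.mem_univ t)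
    (Finset.prod_eq_zero (Finset.mem_univ (Fin.castLE hn k)) ?_))
  rw [hk, hA.diag, Bool.eq_false_of_not_eq_true hG]
  simp

lemma IsMaxProfile.log_lik_le_profileLogLik (hz : IsMaxProfile hn G z) (hA : IsConnMatrix hn A) :
    ENNReal.log (lik G zs A) ≤ profileLogLik hn G z :=
  (logLik_eq_log_lik G zs A).symm.trans_le ((le_iSup₂_of_le A hA le_rfl).trans (hz zs))

lemma IsMaxProfile.lik_le (hz : IsMaxProfile hn G z) (hA : IsConnMatrix hn A) :
    lik G zs A ≤ lik G z (empiricalMatrix G z) := by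
  refine ENNReal.log_le_log_iff.mp ((hz.log_lik_le_profileLogLik hA).trans
    (iSup₂_le fun B hB => ?_))
  rw [logLik_eq_log_lik]
  exact ENNReal.log_le_log (lik_le_lik_empiricalMatrix G z hB.nonneg hB.le_one)

lemma IsMaxProfile.respectsHubs (hz : IsMaxProfile hn G z) (hA : IsConnMatrix hn A)
    (h : lik G zs A ≠ 0) : RespectsHubs hn G z := by
  have hbot : ⊥ < profileLogLik hn G z :=
    (ENNReal.bot_lt_log_iff.mpr (pos_iff_ne_zero.mpr h)).trans_le (hz.log_lik_le_profileLogLik hA)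
  obtain ⟨B, hB⟩ := lt_iSup_iff.mp hbot
  obtain ⟨hB, hpos⟩ := lt_iSup_iff.mp hB
  rw [logLik_eq_log_lik, ENNReal.bot_lt_log_iff] at hpos
  exact respectsHubs_of_lik_ne_zero hB hpos.ne'

end ProfileMaximizer

section SampleLaw

variable {nL n T : ℕ} {hn : nL ≤ n} (θ : Params hn)

instance isProbabilityMeasure_bern_conn (i : Fin (nL + 1)) (j : Fin n) :
    IsProbabilityMeasure (bern (θ.A i j)) :=
  isProbabilityMeasure_bern (θ.conn.nonneg i j) (θ.conn.le_one i j)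

instance isProbabilityMeasure_groupLaw : IsProbabilityMeasure (groupLaw θ) := by
  constructor
  simp only [groupLaw, Measure.coe_finsetSum, Finset.sum_apply, Measure.coe_smul, Pi.smul_apply,
    measure_univ, smul_eq_mul, mul_one]
  rw [← ENNReal.ofReal_sum_of_nonneg fun i _ => θ.ρ_nonneg i, θ.ρ_sum, ENNReal.ofReal_one]

lemma lintegral_groupLaw (f : Fin (nL + 1) × (Fin n → Bool) → ℝ≥0∞) :
    ∫⁻ x, f x ∂groupLaw θ =
      ∑ i, ENNReal.ofReal (θ.ρ i) * ∫⁻ g, f (i, g) ∂Measure.pi fun j => bern (θ.A i j) := by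
  rw [groupLaw, lintegral_finsetSum_measure]
  refine Finset.sum_congr rfl fun i _ => ?_
  rw [lintegral_smul_measure, Measure.dirac_prod, lintegral_map .of_discrete .of_discrete,
    smul_eq_mul]

lemma groupLaw_singleton_prod (i : Fin (nL + 1)) (B : Set (Fin n → Bool)) :
    groupLaw θ ({i} ×ˢ B) =
      ENNReal.ofReal (θ.ρ i) * Measure.pi (fun j => bern (θ.A i j)) B := by
  simp only [groupLaw, Measure.coe_finsetSum, Finset.sum_apply, Measure.coe_smul, Pi.smul_apply,
    smul_eq_mul, Measure.prod_prod]
  rw [Finset.sum_eq_single i (fun k _ hk => by simp [hk]) (by simp)]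
  simp

lemma groupLaw_real_label (i : Fin (nL + 1)) : (groupLaw θ).real {x | x.1 = i} = θ.ρ i := by
  have hprod : {x : Fin (nL + 1) × (Fin n → Bool) | x.1 = i} = {i} ×ˢ Set.univ := by ext; simp
  rw [hprod, measureReal_def, groupLaw_singleton_prod, measure_univ, mul_one,
    ENNReal.toReal_ofReal (θ.ρ_nonneg i)]

lemma groupLaw_real_label_mem (i : Fin (nL + 1)) (j : Fin n) :
    (groupLaw θ).real {x | x.1 = i ∧ x.2 j = true} = θ.ρ i * θ.A i j := by
  have hprod : {x : Fin (nL + 1) × (Fin n → Bool) | x.1 = i ∧ x.2 j = true} =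
      {i} ×ˢ (Function.eval (β := fun _ : Fin n => Bool) j ⁻¹' {true}) := by ext; simp
  rw [hprod, measureReal_def, groupLaw_singleton_prod,
    (measurePreserving_eval (fun j => bern (θ.A i j)) j).measure_preimage
      MeasurableSet.of_discrete.nullMeasurableSet, bern_true, ENNReal.toReal_mul,
    ENNReal.toReal_ofReal (θ.ρ_nonneg i), ENNReal.toReal_ofReal (θ.conn.nonneg i j)]

lemma ae_lik_ne_zero : ∀ᵐ ω ∂sampleLaw θ T, lik (groups ω) (trueLabels ω) θ.A ≠ 0 := by
  rw [ae_iff_of_countable]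
  intro ω hω
  have hgroup (t : Fin T) : groupLaw θ {ω t} ≠ 0 := by
    rw [sampleLaw, Measure.pi_singleton] at hω
    exact Finset.prod_ne_zero_iff.mp hω t (Finset.mem_univ t)
  refine Finset.prod_ne_zero_iff.mpr fun t _ => ?_
  have ht := hgroup t
  rw [← Prod.mk.eta (p := ω t), ← Set.singleton_prod_singleton, groupLaw_singleton_prod,
    Measure.pi_singleton] at ht
  exact right_ne_zero_of_mul ht

end SampleLaw

section LikelihoodRatio

variable {nL n T : ℕ} {hn : nL ≤ n} (θ : Params hn)

/-- The squared distance between the connection probabilities assigned to all observations by the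
labels `zs` with the matrix `A` and by the labels `z` with the matrix `Q`. -/
noncomputable def sqDist (zs z : Fin T → Fin (nL + 1)) (A Q : Fin (nL + 1) → Fin n → ℝ) : ℝ :=
  ∑ t, ∑ j, (A (zs t) j - Q (z t) j) ^ 2

lemma prod_tiltedRatio (G : Fin T → Fin n → Bool) (zs z : Fin T → Fin (nL + 1))
    (A Q : Fin (nL + 1) → Fin n → ℝ) :
    ∏ t, ∏ j, tiltedRatio (A (zs t) j) (Q (z t) j) (G t j) =
      ENNReal.ofReal (Real.exp (sqDist zs z A Q / 2)) *
        (lik G z Q / lik G zs A) ^ (1 / 2 : ℝ) := by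
  have hexp : ENNReal.ofReal (Real.exp (sqDist zs z A Q / 2)) =
      ∏ t, ∏ j, ENNReal.ofReal (Real.exp ((A (zs t) j - Q (z t) j) ^ 2 / 2)) := by
    simp_rw [sqDist, Finset.sum_div, Real.exp_sum]
    rw [ENNReal.ofReal_prod_of_nonneg fun t _ => by positivity]
    exact Finset.prod_congr rfl fun t _ => ENNReal.ofReal_prod_of_nonneg fun j _ => by positivity
  have hratio : lik G z Q / lik G zs A =
      ∏ t, ∏ j, bern (Q (z t) j) {G t j} / bern (A (zs t) j) {G t j} := by
    have htop (t : Fin T) (j : Fin n) : bern (A (zs t) j) {G t j} ≠ ∞ :=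
      bern_singleton_ne_top _ _
    rw [lik, lik, ← ENNReal.prod_div_distrib_of_ne_top fun t _ => ENNReal.prod_ne_top
      fun j _ => htop t j]
    exact Finset.prod_congr rfl fun t _ => (ENNReal.prod_div_distrib_of_ne_top
      fun j _ => htop t j).symm
  simp_rw [tiltedRatio, Finset.prod_mul_distrib,
    ENNReal.prod_rpow_of_nonneg (by norm_num : (0 : ℝ) ≤ 1 / 2), hexp, hratio]

lemma lintegral_prod_tiltedRatio_le_one {q : Fin n → ℝ} (h₀ : ∀ j, 0 ≤ q j) (h₁ : ∀ j, q j ≤ 1) :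
    ∫⁻ x, ∏ j, tiltedRatio (θ.A x.1 j) (q j) (x.2 j) ∂groupLaw θ ≤ 1 := by
  rw [lintegral_groupLaw]
  calc _ ≤ ∑ i, ENNReal.ofReal (θ.ρ i) * 1 := by
        gcongr with i
        rw [lintegral_pi_prod (f := fun j => tiltedRatio (θ.A i j) (q j)) _ fun _ => .of_discrete]
        exact Finset.prod_le_one' fun j _ => lintegral_tiltedRatio_le_one (θ.conn.nonneg i j)
          (θ.conn.le_one i j) (h₀ j) (h₁ j)
    _ = 1 := by
        simp_rw [mul_one]
        rw [← ENNReal.ofReal_sum_of_nonneg fun i _ => θ.ρ_nonneg i, θ.ρ_sum, ENNReal.ofReal_one]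

lemma sampleLaw_lik_le_lik_le (z : Fin T → Fin (nL + 1)) {Q : Fin (nL + 1) → Fin n → ℝ}
    (h₀ : ∀ i j, 0 ≤ Q i j) (h₁ : ∀ i j, Q i j ≤ 1) (s : ℝ) :
    sampleLaw θ T {ω | lik (groups ω) (trueLabels ω) θ.A ≤ lik (groups ω) z Q ∧
      s ≤ sqDist (trueLabels ω) z θ.A Q} ≤ ENNReal.ofReal (Real.exp (-(s / 2))) := by
  rw [Real.exp_neg, ENNReal.ofReal_inv_of_pos (Real.exp_pos _)]
  refine (measure_mono_ae ?_).trans (pi_le_prod_le_inv (fun _ => groupLaw θ)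
    (fun _ => .of_discrete) (fun t => lintegral_prod_tiltedRatio_le_one θ (h₀ (z t)) (h₁ (z t)))
    (ENNReal.ofReal_pos.mpr (Real.exp_pos _)).ne' ENNReal.ofReal_ne_top)
  filter_upwards [ae_lik_ne_zero θ] with ω hω ⟨hlik, hs⟩
  have hratio : 1 ≤ lik (groups ω) z Q / lik (groups ω) (trueLabels ω) θ.A := by
    rw [ENNReal.le_div_iff_mul_le (.inl hω) (.inl ?_), one_mul]
    · exact hlik
    · exact ENNReal.prod_ne_top fun t _ => ENNReal.prod_ne_top fun j _ => bern_singleton_ne_top _ _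
  calc ENNReal.ofReal (Real.exp (s / 2))
      ≤ ENNReal.ofReal (Real.exp (sqDist (trueLabels ω) z θ.A Q / 2)) * 1 := by
        rw [mul_one]; gcongr
    _ ≤ ENNReal.ofReal (Real.exp (sqDist (trueLabels ω) z θ.A Q / 2)) *
        (lik (groups ω) z Q / lik (groups ω) (trueLabels ω) θ.A) ^ (1 / 2 : ℝ) := by
        gcongr
        exact ENNReal.one_le_rpow hratio one_half_pos
    _ = _ := (prod_tiltedRatio _ _ z _ Q).symm

lemma sampleLaw_lik_le_lik_empiricalMatrix_le (z : Fin T → Fin (nL + 1)) (s : ℝ) :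
    sampleLaw θ T {ω | lik (groups ω) (trueLabels ω) θ.A ≤
        lik (groups ω) z (empiricalMatrix (groups ω) z) ∧
      s ≤ sqDist (trueLabels ω) z θ.A (empiricalMatrix (groups ω) z)} ≤
    (T + 1) ^ ((nL + 1) * n) * ENNReal.ofReal (Real.exp (-(s / 2))) := by
  classical
  let M : Finset (Fin (nL + 1) → Fin n → ℝ) := Finset.univ.image fun G => empiricalMatrix G z
  calc _ ≤ sampleLaw θ T (⋃ Q ∈ M, {ω | lik (groups ω) (trueLabels ω) θ.A ≤ lik (groups ω) z Q ∧
          s ≤ sqDist (trueLabels ω) z θ.A Q}) := measure_mono fun ω hω =>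
        Set.mem_biUnion (Finset.mem_image_of_mem _ (Finset.mem_univ (groups ω))) hω
    _ ≤ ∑ _Q ∈ M, ENNReal.ofReal (Real.exp (-(s / 2))) := by
        refine (measure_biUnion_finset_le _ _).trans (Finset.sum_le_sum fun Q hQ => ?_)
        obtain ⟨G, -, rfl⟩ := Finset.mem_image.mp hQ
        exact sampleLaw_lik_le_lik_le θ z (empiricalMatrix_nonneg G z)
          (empiricalMatrix_le_one G z) s
    _ ≤ _ := by
        rw [Finset.sum_const, nsmul_eq_mul]
        gcongr
        exact_mod_cast card_image_empiricalMatrix_le z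

lemma sampleLaw_exists_lik_le_lik_empiricalMatrix_le (s : ℝ) :
    sampleLaw θ T {ω | ∃ z, lik (groups ω) (trueLabels ω) θ.A ≤
        lik (groups ω) z (empiricalMatrix (groups ω) z) ∧
      s ≤ sqDist (trueLabels ω) z θ.A (empiricalMatrix (groups ω) z)} ≤
    ENNReal.ofReal
      (Real.exp (T * Real.log (nL + 1) + (nL + 1) * n * Real.log (T + 1) - s / 2)) := by
  have hexp : Real.exp (T * Real.log (nL + 1) + (nL + 1) * n * Real.log (T + 1) - s / 2) =
      (nL + 1) ^ T * ((T + 1) ^ ((nL + 1) * n) * Real.exp (-(s / 2))) := by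
    rw [sub_eq_add_neg, Real.exp_add, Real.exp_add, Real.exp_nat_mul,
      Real.exp_log (by positivity), mul_assoc]
    have hpow := Real.exp_nat_mul (Real.log (T + 1)) ((nL + 1) * n)
    rw [Real.exp_log (by positivity)] at hpow
    rw [← hpow]
    push_cast
    rfl
  rw [Set.ofPred_exists, hexp]
  refine (measure_iUnion_fintype_le _ _).trans ((Finset.sum_le_sum fun z _ =>
    sampleLaw_lik_le_lik_empiricalMatrix_le θ z s).trans_eq ?_)
  rw [Finset.sum_const, nsmul_eq_mul, ENNReal.ofReal_mul (by positivity),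
    ENNReal.ofReal_mul (by positivity)]
  congr 2
  · simpa using (ENNReal.ofReal_natCast ((nL + 1) ^ T)).symm
  · exact_mod_cast (ENNReal.ofReal_natCast ((T + 1) ^ ((nL + 1) * n))).symm

end LikelihoodRatio

section Separation

lemma exists_nearest_row {ι κ J : Type*} [Finite ι] [Nonempty ι] [Fintype J] {A : ι → J → ℝ}
    {Δ : ℝ} (hgap : ∀ i k, i ≠ k → Δ ≤ ∑ j, (A i j - A k j) ^ 2) (Q : κ → J → ℝ) :
    ∃ σ : κ → ι, ∀ i k, i ≠ σ k → Δ / 4 ≤ ∑ j, (A i j - Q k j) ^ 2 := by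
  choose σ hσ using fun k => Finite.exists_min fun i => ∑ j, (A i j - Q k j) ^ 2
  refine ⟨σ, fun i k hik => ?_⟩
  have htriangle : ∑ j, (A i j - A (σ k) j) ^ 2 ≤
      2 * ∑ j, (A i j - Q k j) ^ 2 + 2 * ∑ j, (A (σ k) j - Q k j) ^ 2 := by
    rw [Finset.mul_sum, Finset.mul_sum, ← Finset.sum_add_distrib]
    gcongr with j
    linarith [sq_nonneg (A i j - Q k j + (A (σ k) j - Q k j))]
  linarith [hgap i (σ k) hik, hσ k i]

variable {nL n T : ℕ}

lemma Separated.le_sum_sq {A : Fin (nL + 1) → Fin n → ℝ} {d v : ℝ} (hsep : Separated A d v)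
    (hd : 0 ≤ d) {i k : Fin (nL + 1)} (hik : i ≠ k) :
    d ^ 2 * v * n / nL ≤ ∑ j, (A i j - A k j) ^ 2 := by
  have hleader (l : Fin nL) (k : Fin (nL + 1)) (hk : k ≠ l.succ) :
      d ^ 2 * v * n / nL ≤ ∑ j, (A l.succ j - A k j) ^ 2 := by
    obtain ⟨V, hV, hgap⟩ := hsep l
    calc d ^ 2 * v * n / nL = v * n / nL * d ^ 2 := by ring
      _ ≤ ∑ _j ∈ V, d ^ 2 := by rw [Finset.sum_const, nsmul_eq_mul]; gcongr
      _ ≤ ∑ j ∈ V, (A l.succ j - A k j) ^ 2 := by gcongr with j hj; exact hgap j hj k hk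
      _ ≤ ∑ j, (A l.succ j - A k j) ^ 2 :=
        Finset.sum_le_univ_sum_of_nonneg fun j => sq_nonneg _
  rcases Fin.eq_zero_or_eq_succ i with rfl | ⟨l, rfl⟩
  · obtain ⟨l, rfl⟩ := Fin.exists_succ_eq.mpr hik.symm
    simp_rw [sub_sq_comm (A 0 _)]
    exact hleader l 0 hik
  · exact hleader l k hik.symm

lemma Separated.sq_mul_le {hn : nL ≤ n} {A : Fin (nL + 1) → Fin n → ℝ} {d v : ℝ}
    (hsep : Separated A d v) (hA : IsConnMatrix hn A) (hd : 0 ≤ d) (hnL : 0 < nL) :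
    d ^ 2 * v ≤ nL := by
  have hn₀ : (0 : ℝ) < n := mod_cast hnL.trans_le hn
  have hentry (j : Fin n) : (A (Fin.succ ⟨0, hnL⟩) j - A 0 j) ^ 2 ≤ 1 := by
    rw [sq_le_one_iff_abs_le_one, abs_le]
    constructor <;>
      linarith [hA.nonneg 0 j, hA.le_one 0 j, hA.nonneg (Fin.succ ⟨0, hnL⟩) j,
        hA.le_one (Fin.succ ⟨0, hnL⟩) j]
  have hsum : d ^ 2 * v * n / nL ≤ n :=
    calc d ^ 2 * v * n / nL ≤ ∑ j, (A (Fin.succ ⟨0, hnL⟩) j - A 0 j) ^ 2 :=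
          hsep.le_sum_sq hd (Fin.succ_ne_zero _)
      _ ≤ ∑ _j : Fin n, 1 := Finset.sum_le_sum fun j _ => hentry j
      _ = n := by simp
  rw [div_le_iff₀ (by positivity), mul_comm (n : ℝ)] at hsum
  exact le_of_mul_le_mul_right hsum hn₀

lemma Separated.mul_div_le {hn : nL ≤ n} {A : Fin (nL + 1) → Fin n → ℝ} {d v L : ℝ}
    (hsep : Separated A d v) (hA : IsConnMatrix hn A) (hd : 0 < d) (hv : 0 < v) (hL : 0 ≤ L) :
    nL * L / (d ^ 2 * v * n) ≤ nL ^ 2 * L / (d ^ 4 * v ^ 2 * n) := by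
  rcases nL.eq_zero_or_pos with rfl | hnL
  · simp
  calc nL * L / (d ^ 2 * v * n) = nL * L * (d ^ 2 * v) / (d ^ 4 * v ^ 2 * n) := by
        have hn₀ : (0 : ℝ) < n := mod_cast hnL.trans_le hn
        field_simp
    _ ≤ nL * L * nL / (d ^ 4 * v ^ 2 * n) := by
        gcongr
        exact hsep.sq_mul_le hA hd.le hnL
    _ = nL ^ 2 * L / (d ^ 4 * v ^ 2 * n) := by ring

lemma mul_errorRate_le_sqDist {A : Fin (nL + 1) → Fin n → ℝ} {Q : Fin (nL + 1) → Fin n → ℝ}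
    {σ : Fin (nL + 1) → Fin (nL + 1)} {c : ℝ}
    (hσ : ∀ i k, i ≠ σ k → c ≤ ∑ j, (A i j - Q k j) ^ 2) (zs z : Fin T → Fin (nL + 1)) :
    c * (T * errorRate zs (σ ∘ z)) ≤ sqDist zs z A Q := by
  have hcard : T * errorRate zs (σ ∘ z) = (Finset.univ.filter fun t => zs t ≠ σ (z t)).card := by
    rcases T.eq_zero_or_pos with rfl | hT
    · simp
    · rw [errorRate, mul_div_cancel₀ _ (by positivity)]
      rfl
  calc c * (T * errorRate zs (σ ∘ z)) = ∑ t with zs t ≠ σ (z t), c := by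
        rw [hcard, Finset.sum_const, nsmul_eq_mul, mul_comm]
    _ ≤ ∑ t with zs t ≠ σ (z t), ∑ j, (A (zs t) j - Q (z t) j) ^ 2 := by
        gcongr with t ht
        exact hσ _ _ (Finset.mem_filter.mp ht).2
    _ ≤ sqDist zs z A Q :=
        Finset.sum_le_univ_sum_of_nonneg fun t => Finset.sum_nonneg fun j _ => sq_nonneg _

/-- The labels `z` respect the hubs and determine the labels `zs`, through some relabelling, up to
a fraction less than `η` of errors. -/
def IsPure (hn : nL ≤ n) (G : Fin T → Fin n → Bool) (zs z : Fin T → Fin (nL + 1)) (η : ℝ) : Prop :=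
  RespectsHubs hn G z ∧ ∃ σ : Fin (nL + 1) → Fin (nL + 1), errorRate zs (σ ∘ z) < η

lemma isPure_of_eq_zero {hn : nL ≤ n} (hnL : nL = 0) (G : Fin T → Fin n → Bool)
    (zs z : Fin T → Fin (nL + 1)) {η : ℝ} (hη : 0 < η) : IsPure hn G zs z η := by
  subst hnL
  have : Subsingleton (Fin (0 + 1)) := inferInstanceAs (Subsingleton (Fin 1))
  refine ⟨fun t k => k.elim0, id, ?_⟩
  have hzs : zs = id ∘ z := Subsingleton.elim _ _
  simpa [errorRate, hzs] using hη

lemma sampleLaw_not_isPure_le {hn : nL ≤ n} (θ : Params hn)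
    {z : Sample nL n T → Fin T → Fin (nL + 1)}
    (hz : ∀ ω, IsMaxProfile hn (groups ω) (z ω)) {Δ : ℝ} (hΔ : 0 ≤ Δ)
    (hgap : ∀ i k, i ≠ k → Δ ≤ ∑ j, (θ.A i j - θ.A k j) ^ 2) (η : ℝ) :
    sampleLaw θ T {ω | ¬ IsPure hn (groups ω) (trueLabels ω) (z ω) η} ≤
      ENNReal.ofReal (Real.exp
        (T * Real.log (nL + 1) + (nL + 1) * n * Real.log (T + 1) - Δ / 4 * (T * η) / 2)) := by
  refine (measure_mono_ae ?_).trans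
    (sampleLaw_exists_lik_le_lik_empiricalMatrix_le θ (Δ / 4 * (T * η)))
  filter_upwards [ae_lik_ne_zero θ] with ω hω himpure
  obtain ⟨σ, hσ⟩ := exists_nearest_row hgap (empiricalMatrix (groups ω) (z ω))
  have hη : η ≤ errorRate (trueLabels ω) (σ ∘ z ω) := by
    by_contra! hlt
    exact himpure ⟨(hz ω).respectsHubs θ.conn hω, σ, hlt⟩
  refine ⟨z ω, (hz ω).lik_le θ.conn, le_trans ?_ (mul_errorRate_le_sqDist hσ _ _)⟩
  gcongr

end Separation

section Typical

variable {nL n T : ℕ} {hn : nL ≤ n} (θ : Params hn)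

lemma Params.one_le_mul_of_forall_le {r : ℝ}
    (hr : ∀ i, θ.ρ i ≤ r) : 1 ≤ (nL + 1) * r := by
  simpa [θ.ρ_sum] using Finset.sum_le_card_nsmul Finset.univ θ.ρ r fun i _ => hr i

lemma Params.mul_le_one_of_forall_le {r : ℝ}
    (hr : ∀ i, r ≤ θ.ρ i) : (nL + 1) * r ≤ 1 := by
  simpa [θ.ρ_sum] using Finset.card_nsmul_le_sum Finset.univ θ.ρ r fun i _ => hr i

/-- The frequencies of the labels, and of the labels together with a given leader belonging to the
group, are within `s` of their probabilities. -/
def IsTypical (s : ℝ) (ω : Sample nL n T) : Prop :=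
  (∀ i, |freq (fun t => trueLabels ω t = i) - θ.ρ i| < s) ∧
    ∀ i (k : Fin nL), |freq (fun t => trueLabels ω t = i ∧ groups ω t (Fin.castLE hn k) = true) -
      θ.ρ i * θ.A i (Fin.castLE hn k)| < s

lemma LeaderBound.sum_le {b : ℝ} (hb : LeaderBound hn θ.A b) (i : Fin (nL + 1)) :
    ∑ k : Fin nL, θ.A i (Fin.castLE hn k) ≤ 1 + nL * b := by
  have hentry (k : Fin nL) : θ.A i (Fin.castLE hn k) ≤ (if i = k.succ then 1 else 0) + b := by
    have hb₀ : 0 ≤ b := (θ.conn.nonneg 0 _).trans (hb 0 k (Fin.succ_ne_zero k).symm)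
    split_ifs with hik
    · linarith [θ.conn.le_one i (Fin.castLE hn k)]
    · linarith [hb i k hik]
  have hhub : ∑ k : Fin nL, (if i = k.succ then (1 : ℝ) else 0) ≤ 1 := by
    rcases Fin.eq_zero_or_eq_succ i with rfl | ⟨l, rfl⟩ <;> simp [Fin.succ_ne_zero, eq_comm]
  calc ∑ k : Fin nL, θ.A i (Fin.castLE hn k)
      ≤ ∑ k : Fin nL, ((if i = k.succ then 1 else 0) + b) := Finset.sum_le_sum fun k _ => hentry k
    _ ≤ 1 + nL * b := by
      rw [Finset.sum_add_distrib, Finset.sum_const, Finset.card_univ, Fintype.card_fin,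
        nsmul_eq_mul]
      gcongr

lemma sampleLaw_not_isTypical_le (hT : 0 < T) {b s : ℝ} (hb : LeaderBound hn θ.A b) (hs : 0 < s) :
    sampleLaw θ T {ω | ¬ IsTypical θ s ω} ≤ ENNReal.ofReal ((2 + nL * b) / (T * s ^ 2)) := by
  have : Nonempty (Fin T) := ⟨⟨0, hT⟩⟩
  let E : Fin (nL + 1) ⊕ Fin (nL + 1) × Fin nL → Set (Fin (nL + 1) × (Fin n → Bool)) :=
    Sum.elim (fun i => {x | x.1 = i}) fun p => {x | x.1 = p.1 ∧ x.2 (Fin.castLE hn p.2) = true}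
  have hsum : ∑ p, (groupLaw θ).real (E p) ≤ 2 + nL * b := by
    simp only [E, Fintype.sum_sum_type, Fintype.sum_prod_type, Sum.elim_inl, Sum.elim_inr,
      groupLaw_real_label, groupLaw_real_label_mem, ← Finset.mul_sum, θ.ρ_sum]
    calc 1 + ∑ i, θ.ρ i * ∑ k : Fin nL, θ.A i (Fin.castLE hn k)
        ≤ 1 + ∑ i, θ.ρ i * (1 + nL * b) := by
          gcongr with i
          exacts [θ.ρ_nonneg i, hb.sum_le θ i]
      _ = 2 + nL * b := by rw [← Finset.sum_mul, θ.ρ_sum]; ring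
  calc sampleLaw θ T {ω | ¬ IsTypical θ s ω}
      ≤ sampleLaw θ T {ω | ∃ p, s ≤ |freq (fun t => ω t ∈ E p) - (groupLaw θ).real (E p)|} := by
        refine measure_mono fun ω => not_imp_comm.mp fun hdev => ?_
        simpa [E, IsTypical, trueLabels, groups, groupLaw_real_label, groupLaw_real_label_mem]
          using hdev
    _ ≤ ENNReal.ofReal ((∑ p, (groupLaw θ).real (E p)) / (T * s ^ 2)) := by
        simpa only [sampleLaw, Fintype.card_fin] using
          pi_exists_freq_deviation_le (τ := Fin T) (groupLaw θ)
            (fun p => .of_discrete (s := E p)) hs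
    _ ≤ ENNReal.ofReal ((2 + nL * b) / (T * s ^ 2)) := by gcongr

end Typical

section Relabelling

variable {nL n T : ℕ} {hn : nL ≤ n} {G : Fin T → Fin n → Bool} {zs z : Fin T → Fin (nL + 1)}
  {σ : Fin (nL + 1) → Fin (nL + 1)}

lemma RespectsHubs.freq_class_le (hG : RespectsHubs hn G z) (i : Fin (nL + 1)) (k : Fin nL) :
    freq (fun t => z t = k.succ ∧ zs t = i) ≤
      freq (fun t => zs t = i ∧ G t (Fin.castLE hn k) = true) :=
  freq_mono fun t ht => ⟨ht.2, hG t k ht.1⟩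

lemma RespectsHubs.errorRate_le_of_rare (hG : RespectsHubs hn G z)
    (σ : Fin (nL + 1) → Fin (nL + 1)) {a c : ℝ} (hlabel : ∀ i, freq (fun t => zs t = i) ≤ a)
    (hleader : ∀ i (k : Fin nL), i ≠ k.succ →
      freq (fun t => zs t = i ∧ G t (Fin.castLE hn k) = true) ≤ c) :
    errorRate zs z ≤ errorRate zs (σ ∘ z) + (a + nL * c) := by
  simp_rw [errorRate_eq_freq, Function.comp_apply]
  have hclass (k : Fin nL) :
      freq (fun t => z t = k.succ ∧ zs t = σ k.succ ∧ σ k.succ ≠ k.succ) ≤ c := by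
    by_cases hk : σ k.succ = k.succ
    · have hc : 0 ≤ c := (freq_nonneg _).trans (hleader 0 k (Fin.succ_ne_zero k).symm)
      simpa [hk, freq] using hc
    · simp only [ne_eq, hk, not_false_eq_true, and_true]
      exact (hG.freq_class_le _ k).trans (hleader _ k hk)
  calc freq (fun t => zs t ≠ z t)
      ≤ freq (fun t => zs t ≠ σ (z t) ∨ ∃ k, z t = k ∧ zs t = σ k ∧ σ k ≠ k) :=
        freq_mono fun t ht => or_iff_not_imp_left.mpr fun h =>
          ⟨z t, rfl, not_not.mp h, fun hk => ht ((not_not.mp h).trans hk)⟩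
    _ ≤ freq (fun t => zs t ≠ σ (z t)) +
          ∑ k, freq (fun t => z t = k ∧ zs t = σ k ∧ σ k ≠ k) :=
        (freq_or_le _ _).trans (by gcongr; exact freq_exists_le _)
    _ ≤ freq (fun t => zs t ≠ σ (z t)) + (a + nL * c) := by
      rw [Fin.sum_univ_succ]
      gcongr
      · exact (freq_mono fun t ht => ht.2.1).trans (hlabel (σ 0))
      · exact (Finset.sum_le_sum fun k _ => hclass k).trans_eq (by simp)

lemma surjective_of_errorRate_lt_freq
    (hfreq : ∀ i, errorRate zs (σ ∘ z) < freq (fun t => zs t = i)) : Function.Surjective σ := by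
  intro i
  by_contra! hi
  refine (hfreq i).not_ge ?_
  rw [errorRate_eq_freq]
  exact freq_mono fun t ht => ht ▸ (hi (z t)).symm

lemma RespectsHubs.eq_id_of_frequent (hG : RespectsHubs hn G z)
    (hfreq : ∀ i, errorRate zs (σ ∘ z) < freq (fun t => zs t = i))
    (hleader : ∀ i (k : Fin nL), i ≠ k.succ →
      freq (fun t => zs t = i ∧ G t (Fin.castLE hn k) = true) + errorRate zs (σ ∘ z) <
        freq (fun t => zs t = i)) :
    σ = id := by
  have hinj : Function.Injective σ :=
    Finite.injective_iff_surjective.mpr (surjective_of_errorRate_lt_freq hfreq)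
  have hsucc (k : Fin nL) : σ k.succ = k.succ := by
    by_contra hk
    refine (hleader _ k hk).not_ge ?_
    calc freq (fun t => zs t = σ k.succ)
        ≤ freq (fun t => (z t = k.succ ∧ zs t = σ k.succ) ∨ zs t ≠ σ (z t)) :=
          freq_mono fun t ht => or_iff_not_imp_right.mpr fun h =>
            ⟨hinj ((not_not.mp h).symm.trans ht), ht⟩
      _ ≤ freq (fun t => z t = k.succ ∧ zs t = σ k.succ) + errorRate zs (σ ∘ z) := by
          rw [errorRate_eq_freq]
          exact freq_or_le _ _
      _ ≤ freq (fun t => zs t = σ k.succ ∧ G t (Fin.castLE hn k) = true) +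
            errorRate zs (σ ∘ z) := by
          gcongr
          exact hG.freq_class_le _ k
  have hzero : σ 0 = 0 := by
    by_contra h
    obtain ⟨k, hk⟩ := Fin.exists_succ_eq.mpr h
    exact Fin.succ_ne_zero k (hinj ((hsucc k).trans hk))
  exact funext fun i => Fin.cases hzero hsucc i

end Relabelling

section PureTypical

variable {nL n T : ℕ} {hn : nL ≤ n} {θ : Params hn} {ω : Sample nL n T}
  {z : Fin T → Fin (nL + 1)} {η s b : ℝ}

lemma IsPure.errorRate_lt_of_rare (hpure : IsPure hn (groups ω) (trueLabels ω) z η)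
    (htyp : IsTypical θ s ω) {r : ℝ} (hρ : ∀ i, θ.ρ i ≤ r) (hb : LeaderBound hn θ.A b) :
    errorRate (trueLabels ω) z < η + (r + s + nL * (r * b + s)) := by
  obtain ⟨hG, σ, hσ⟩ := hpure
  have hlabel (i) : freq (fun t => trueLabels ω t = i) ≤ r + s := by
    linarith [(abs_lt.mp (htyp.1 i)).2, hρ i]
  have hleader (i) (k : Fin nL) (hik : i ≠ k.succ) :
      freq (fun t => trueLabels ω t = i ∧ groups ω t (Fin.castLE hn k) = true) ≤ r * b + s := by
    have hmean : θ.ρ i * θ.A i (Fin.castLE hn k) ≤ r * b :=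
      mul_le_mul (hρ i) (hb i k hik) (θ.conn.nonneg _ _) ((θ.ρ_nonneg i).trans (hρ i))
    linarith [(abs_lt.mp (htyp.2 i k)).2]
  linarith [hG.errorRate_le_of_rare σ hlabel hleader]

lemma IsPure.errorRate_lt_of_frequent (hpure : IsPure hn (groups ω) (trueLabels ω) z η)
    (htyp : IsTypical θ s ω) {cmin : ℝ} (hρ : ∀ i, cmin ≤ θ.ρ i) (hb₁ : b < 1)
    (hb : LeaderBound hn θ.A b) (hcmin : η + s < cmin) (hgap : η + 2 * s < (1 - b) * cmin) :
    errorRate (trueLabels ω) z < η := by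
  obtain ⟨hG, σ, hσ⟩ := hpure
  have hfreq (i) : θ.ρ i - s < freq (fun t => trueLabels ω t = i) := by
    linarith [(abs_lt.mp (htyp.1 i)).1]
  have hid : σ = id := by
    refine hG.eq_id_of_frequent (fun i => by linarith [hfreq i, hρ i]) fun i k hik => ?_
    have hmean : θ.ρ i * θ.A i (Fin.castLE hn k) ≤ θ.ρ i * b :=
      mul_le_mul_of_nonneg_left (hb i k hik) (θ.ρ_nonneg i)
    have hmargin : (1 - b) * cmin ≤ (1 - b) * θ.ρ i :=
      mul_le_mul_of_nonneg_left (hρ i) (by linarith)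
    linarith [(abs_lt.mp (htyp.2 i k)).2, hfreq i]
  rwa [hid] at hσ

end PureTypical

section Rates

lemma log_succ_le_two_mul_log {N : ℕ} (hN : 2 ≤ N) :
    Real.log (N + 1) ≤ 2 * Real.log N := by
  have hN' : (2 : ℝ) ≤ N := mod_cast hN
  calc Real.log (N + 1) ≤ Real.log ((N : ℝ) ^ 2) := Real.log_le_log (by positivity) (by nlinarith)
    _ = 2 * Real.log N := by rw [Real.log_pow]; norm_num

lemma impurity_exponent_le {nL n T : ℕ} (hnL : 0 < nL) (hn : nL ≤ n) (hT : 2 ≤ T) {d v η : ℝ}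
    (hd : 0 < d) (hv : 0 < v)
    (hn_rate : nL * Real.log (nL + 1) / (d ^ 2 * v * n) ≤ η / 48)
    (hT_rate : nL ^ 2 * Real.log T / (d ^ 2 * v * T) ≤ η / 48) :
    T * Real.log (nL + 1) + (nL + 1) * n * Real.log (T + 1) -
      d ^ 2 * v * n / nL / 4 * (T * η) / 2 ≤ -(Real.log 2 * T) := by
  have hnL₁ : (1 : ℝ) ≤ nL := mod_cast hnL
  have hn₀ : (0 : ℝ) < n := mod_cast hnL.trans_le hn
  have hT₀ : (0 : ℝ) < T := by positivity
  set X : ℝ := T * (d ^ 2 * v * n / nL) with hX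
  have hlabels : T * Real.log (nL + 1) ≤ η / 48 * X :=
    calc T * Real.log (nL + 1) = nL * Real.log (nL + 1) / (d ^ 2 * v * n) * X := by
          rw [hX]; field_simp
      _ ≤ η / 48 * X := by gcongr
  have hmatrices : (nL + 1) * n * Real.log (T + 1) ≤ 4 * (η / 48 * X) :=
    calc (nL + 1) * n * Real.log (T + 1) ≤ (nL + nL) * n * (2 * Real.log T) := by
          gcongr
          exacts [Real.log_nonneg (by linarith), log_succ_le_two_mul_log hT]
      _ = 4 * (nL ^ 2 * Real.log T / (d ^ 2 * v * T) * X) := by rw [hX]; field_simp; ring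
      _ ≤ 4 * (η / 48 * X) := by gcongr
  have hlog : Real.log 2 * T ≤ T * Real.log (nL + 1) := by
    rw [mul_comm]
    gcongr
    linarith
  have hgain : d ^ 2 * v * n / nL / 4 * (T * η) / 2 = 6 * (η / 48 * X) := by rw [hX]; ring
  rw [hgain]
  linarith

end Rates

section Sequences

variable {nL n T : ℕ → ℕ} {hn : ∀ m, nL m ≤ n m} {θ : ∀ m, Params (hn m)} {d v : ℕ → ℝ}
  {zhat : ∀ m, Sample (nL m) (n m) (T m) → Fin (T m) → Fin (nL m + 1)}

lemma tendsto_zero_of_le_ofReal {ι : Type*} {l : Filter ι} {f : ι → ℝ≥0∞} {g : ι → ℝ}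
    (hg : Tendsto g l (𝓝 0)) (h : ∀ᶠ m in l, f m ≤ ENNReal.ofReal (g m)) : Tendsto f l (𝓝 0) :=
  tendsto_of_tendsto_of_tendsto_of_le_of_le' tendsto_const_nhds
    (by simpa using ENNReal.tendsto_ofReal hg) (.of_forall fun _ => zero_le) h

lemma tendsto_sampleLaw_not_isPure (hz : ∀ m ω, IsMaxProfile (hn m) (groups ω) (zhat m ω))
    (hT : Tendsto T atTop atTop) (hd : ∀ m, 0 < d m) (hv : ∀ m, 0 < v m)
    (hsep : ∀ m, Separated (θ m).A (d m) (v m))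
    (hn_rate : Tendsto (fun m => nL m * Real.log (nL m + 1) / (d m ^ 2 * v m * n m)) atTop (𝓝 0))
    (hT_rate : Tendsto (fun m => (nL m : ℝ) ^ 2 * Real.log (T m) / (d m ^ 2 * v m * T m))
      atTop (𝓝 0)) {η : ℝ} (hη : 0 < η) :
    Tendsto (fun m => sampleLaw (θ m) (T m)
      {ω | ¬ IsPure (hn m) (groups ω) (trueLabels ω) (zhat m ω) η}) atTop (𝓝 0) := by
  have hdecay : Tendsto (fun m => Real.exp (-(Real.log 2 * T m))) atTop (𝓝 0) :=
    Real.tendsto_exp_neg_atTop_nhds_zero.comp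
      ((tendsto_natCast_atTop_atTop.comp hT).const_mul_atTop (Real.log_pos one_lt_two))
  refine tendsto_zero_of_le_ofReal hdecay ?_
  filter_upwards [hT.eventually_ge_atTop 2,
    hn_rate.eventually_le_const (show 0 < η / 48 by positivity),
    hT_rate.eventually_le_const (show 0 < η / 48 by positivity)] with m hT hn_rate hT_rate
  rcases (nL m).eq_zero_or_pos with hnL | hnL
  · simp [isPure_of_eq_zero hnL _ _ _ hη]
  have hd := hd m
  have hv := hv m
  refine (sampleLaw_not_isPure_le (θ m) (hz m) (by positivity)
    (fun i k => (hsep m).le_sum_sq hd.le) η).trans ?_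
  gcongr
  exact impurity_exponent_le hnL (hn m) hT hd hv hn_rate hT_rate

lemma tendsto_sampleLaw_not_isTypical (hT : Tendsto T atTop atTop) {b s : ℕ → ℝ}
    (hb : ∀ m, LeaderBound (hn m) (θ m).A (b m)) (hs : ∀ᶠ m in atTop, 0 < s m)
    (h : Tendsto (fun m => (2 + nL m * b m) / (T m * s m ^ 2)) atTop (𝓝 0)) :
    Tendsto (fun m => sampleLaw (θ m) (T m) {ω | ¬ IsTypical (θ m) (s m) ω}) atTop (𝓝 0) := by
  refine tendsto_zero_of_le_ofReal h ?_
  filter_upwards [hT.eventually_gt_atTop 0, hs] with m hT hs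
  exact sampleLaw_not_isTypical_le (θ m) hT (hb m) hs

lemma tendsto_sampleLaw_of_isPure_of_isTypical {η : ℝ} {s : ℕ → ℝ}
    {E : ∀ m, Set (Sample (nL m) (n m) (T m))}
    (hpure : Tendsto (fun m => sampleLaw (θ m) (T m)
      {ω | ¬ IsPure (hn m) (groups ω) (trueLabels ω) (zhat m ω) η}) atTop (𝓝 0))
    (htyp : Tendsto (fun m => sampleLaw (θ m) (T m) {ω | ¬ IsTypical (θ m) (s m) ω}) atTop (𝓝 0))
    (h : ∀ᶠ m in atTop, ∀ ω, IsPure (hn m) (groups ω) (trueLabels ω) (zhat m ω) η →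
      IsTypical (θ m) (s m) ω → ω ∉ E m) :
    Tendsto (fun m => sampleLaw (θ m) (T m) (E m)) atTop (𝓝 0) := by
  refine tendsto_of_tendsto_of_tendsto_of_le_of_le' tendsto_const_nhds
    (by simpa using hpure.add htyp) (.of_forall fun _ => zero_le) ?_
  filter_upwards [h] with m hm
  refine (measure_mono fun ω hω => ?_).trans (measure_union_le _ _)
  by_contra hgood
  simp only [Set.mem_union, Set.mem_ofPred_eq, not_or, not_not] at hgood
  exact hm ω hgood.1 hgood.2 hω

end Sequences

section Consistency

variable {nL n T : ℕ → ℕ} {hn : ∀ m, nL m ≤ n m} {θ : ∀ m, Params (hn m)}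
  {zhat : ∀ m, Sample (nL m) (n m) (T m) → Fin (T m) → Fin (nL m + 1)}

lemma tendsto_errorRate_of_rare (hT : Tendsto T atTop atTop)
    (hpure : ∀ η : ℝ, 0 < η → Tendsto (fun m => sampleLaw (θ m) (T m)
      {ω | ¬ IsPure (hn m) (groups ω) (trueLabels ω) (zhat m ω) η}) atTop (𝓝 0))
    {r : ℕ → ℝ} {c₀ : ℝ} (hr : Tendsto r atTop (𝓝 0)) (hρ : ∀ m i, (θ m).ρ i ≤ r m)
    (hb : ∀ m, LeaderBound (hn m) (θ m).A (c₀ / nL m))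
    (hnT : Tendsto (fun m => (nL m : ℝ) ^ 2 / T m) atTop (𝓝 0)) {ε : ℝ} (hε : 0 < ε) :
    Tendsto (fun m => sampleLaw (θ m) (T m) {ω | ε ≤ errorRate (trueLabels ω) (zhat m ω)})
      atTop (𝓝 0) := by
  set η : ℝ := ε / 4
  have hη : 0 < η := by positivity
  have hnL : ∀ᶠ m in atTop, 0 < nL m := by
    filter_upwards [hr.eventually_lt_const one_pos] with m hm
    by_contra! hzero
    have hsum := (θ m).one_le_mul_of_forall_le (hρ m)
    simp only [Nat.le_zero.mp hzero, Nat.cast_zero, zero_add, one_mul] at hsum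
    linarith
  have hvar : Tendsto (fun m => (2 + nL m * (c₀ / nL m)) / (T m * (η / nL m) ^ 2)) atTop (𝓝 0) := by
    have hlim := hnT.const_mul ((2 + c₀) / η ^ 2)
    rw [mul_zero] at hlim
    refine hlim.congr' ?_
    filter_upwards [hnL] with m hm
    field_simp
  have hs : ∀ᶠ m in atTop, 0 < η / nL m := hnL.mono fun m hm => by positivity
  have hsmall : ∀ᶠ m in atTop, r m * (1 + c₀) < η := by
    refine Tendsto.eventually_lt_const hη ?_
    simpa using hr.mul_const (1 + c₀)
  refine tendsto_sampleLaw_of_isPure_of_isTypical (hpure η hη)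
    (tendsto_sampleLaw_not_isTypical hT hb hs hvar) ?_
  filter_upwards [hnL, hsmall] with m hnL hsmall ω hωpure hωtyp
  have hs : η / nL m ≤ η := div_le_self hη.le (mod_cast hnL)
  have hleaders : nL m * (r m * (c₀ / nL m) + η / nL m) = r m * c₀ + η := by field_simp
  have herr := hωpure.errorRate_lt_of_rare hωtyp (hρ m) (hb m)
  rw [hleaders] at herr
  refine not_le.mpr ?_
  linarith [show 4 * η = ε by ring]

lemma tendsto_errorRate_of_frequent (hT : Tendsto T atTop atTop)
    (hpure : ∀ η : ℝ, 0 < η → Tendsto (fun m => sampleLaw (θ m) (T m)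
      {ω | ¬ IsPure (hn m) (groups ω) (trueLabels ω) (zhat m ω) η}) atTop (𝓝 0))
    {cmin b : ℝ} (hcmin : 0 < cmin) (hρ : ∀ m i, cmin ≤ (θ m).ρ i) (hb₁ : b < 1)
    (hb : ∀ m, LeaderBound (hn m) (θ m).A b) {ε : ℝ} (hε : 0 < ε) :
    Tendsto (fun m => sampleLaw (θ m) (T m) {ω | ε ≤ errorRate (trueLabels ω) (zhat m ω)})
      atTop (𝓝 0) := by
  have hgap : 0 < (1 - b) * cmin := mul_pos (sub_pos.mpr hb₁) hcmin
  obtain ⟨η, hη, hηmin⟩ :=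
    exists_between (lt_min hε (lt_min (half_pos hcmin) (div_pos hgap three_pos)))
  obtain ⟨hηε, hηc, hηb⟩ : η < ε ∧ η < cmin / 2 ∧ η < (1 - b) * cmin / 3 := by
    simpa only [lt_min_iff] using hηmin
  have hvar : Tendsto (fun m => (2 + nL m * (1 : ℝ)) / (T m * η ^ 2)) atTop (𝓝 0) := by
    refine squeeze_zero (fun m => by positivity) (fun m => ?_)
      (((tendsto_natCast_atTop_atTop.comp hT).atTop_mul_const (pow_pos hη 2)).const_div_atTop
        (2 + 1 / cmin))
    have hcount : (nL m : ℝ) * 1 ≤ 1 / cmin := by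
      rw [le_div_iff₀ hcmin]
      linarith [(θ m).mul_le_one_of_forall_le (hρ m)]
    simp only [Function.comp_apply]
    gcongr
  refine tendsto_sampleLaw_of_isPure_of_isTypical (hpure η hη)
    (tendsto_sampleLaw_not_isTypical hT (fun m k i _ => (θ m).conn.le_one k _) (.of_forall
      fun _ => hη) hvar) (.of_forall fun m ω hωpure hωtyp => ?_)
  have herr := hωpure.errorRate_lt_of_frequent hωtyp (hρ m) hb₁ (hb m) (by linarith) (by linarith)
  exact not_le.mpr (herr.trans hηε)

end Consistency

section GrowingRates

variable {nL n T : ℕ → ℕ} {hn : ∀ m, nL m ≤ n m} {θ : ∀ m, Params (hn m)} {d v : ℕ → ℝ}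

lemma tendsto_node_rate_of_growing (hnL : Tendsto nL atTop atTop) (hd : ∀ m, 0 < d m)
    (hv : ∀ m, 0 < v m) (hsep : ∀ m, Separated (θ m).A (d m) (v m))
    (h : Tendsto (fun m => (nL m : ℝ) ^ 8 * Real.log (nL m) / (d m ^ 4 * v m ^ 2 * (n m : ℝ)))
      atTop (𝓝 0)) :
    Tendsto (fun m => nL m * Real.log (nL m + 1) / (d m ^ 2 * v m * n m)) atTop (𝓝 0) := by
  have hlog (m : ℕ) : 0 ≤ Real.log ((nL m : ℝ) + 1) := Real.log_nonneg (by simp)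
  have hlim := h.const_mul 2
  rw [mul_zero] at hlim
  refine squeeze_zero' (.of_forall fun m => ?_) ?_ hlim
  · have hv := hv m
    have hlog := hlog m
    positivity
  filter_upwards [hnL.eventually_ge_atTop 2] with m hm
  have hnL₁ : (1 : ℝ) ≤ nL m := mod_cast one_le_two.trans hm
  have hv := hv m
  calc nL m * Real.log (nL m + 1) / (d m ^ 2 * v m * n m)
      ≤ (nL m : ℝ) ^ 2 * Real.log (nL m + 1) / (d m ^ 4 * v m ^ 2 * n m) :=
        (hsep m).mul_div_le (θ m).conn (hd m) hv (hlog m)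
    _ ≤ (nL m : ℝ) ^ 8 * (2 * Real.log (nL m)) / (d m ^ 4 * v m ^ 2 * n m) := by
        gcongr
        exacts [hlog m, by norm_num, log_succ_le_two_mul_log hm]
    _ = 2 * ((nL m : ℝ) ^ 8 * Real.log (nL m) / (d m ^ 4 * v m ^ 2 * n m)) := by ring

lemma tendsto_group_rate_of_growing (hv : ∀ m, 0 < v m)
    (h : Tendsto (fun m => (nL m : ℝ) ^ 5 * Real.log (T m) / (d m ^ 2 * v m * (T m : ℝ)))
      atTop (𝓝 0)) :
    Tendsto (fun m => (nL m : ℝ) ^ 2 * Real.log (T m) / (d m ^ 2 * v m * T m)) atTop (𝓝 0) := by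
  refine squeeze_zero (fun m => ?_) (fun m => ?_) h
  · have hv := hv m
    positivity
  · have hv := hv m
    rcases (nL m).eq_zero_or_pos with hnL | hnL
    · simp [hnL]
    · gcongr
      exacts [mod_cast hnL, by norm_num]

lemma tendsto_sq_div_of_growing (hnL : Tendsto nL atTop atTop)
    (h : Tendsto (fun m => (nL m : ℝ) ^ 2 * Real.log (nL m) / (T m : ℝ)) atTop (𝓝 0)) :
    Tendsto (fun m => (nL m : ℝ) ^ 2 / T m) atTop (𝓝 0) := by
  refine squeeze_zero' (.of_forall fun m => by positivity) ?_ h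
  filter_upwards [hnL.eventually_ge_atTop 3] with m hm
  have hm' : (3 : ℝ) ≤ nL m := mod_cast hm
  have hlog : 1 ≤ Real.log (nL m) :=
    (Real.le_log_iff_exp_le (by linarith)).mpr (Real.exp_one_lt_three.le.trans hm')
  gcongr
  exact le_mul_of_one_le_right (by positivity) hlog

end GrowingRates

section FixedRates

variable {nL : ℕ} {n T : ℕ → ℕ} {hn : ∀ m, nL ≤ n m} {θ : ∀ m, Params (hn m)} {d v : ℕ → ℝ}

lemma tendsto_node_rate_of_fixed (hd : ∀ m, 0 < d m) (hv : ∀ m, 0 < v m)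
    (hsep : ∀ m, Separated (θ m).A (d m) (v m))
    (h : Tendsto (fun m => d m ^ 4 * v m ^ 2 * (n m : ℝ)) atTop atTop) :
    Tendsto (fun m => nL * Real.log (nL + 1) / (d m ^ 2 * v m * n m)) atTop (𝓝 0) := by
  have hlog : 0 ≤ Real.log ((nL : ℝ) + 1) := Real.log_nonneg (by simp)
  refine squeeze_zero (fun m => ?_) (fun m => (hsep m).mul_div_le (θ m).conn (hd m) (hv m) hlog)
    (h.const_div_atTop _)
  have hv := hv m
  positivity

lemma tendsto_group_rate_of_fixed
    (h : Tendsto (fun m => Real.log (T m) / (d m ^ 2 * v m * (T m : ℝ))) atTop (𝓝 0)) :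
    Tendsto (fun m => (nL : ℝ) ^ 2 * Real.log (T m) / (d m ^ 2 * v m * T m)) atTop (𝓝 0) := by
  simpa only [mul_div_assoc, mul_zero] using h.const_mul ((nL : ℝ) ^ 2)

end FixedRates

end HubNull

theorem theorem9_general {nL n T : ℕ → ℕ} {hn : ∀ m, nL m ≤ n m}
    {θ : ∀ m, HubNull.Params (hn m)} {d v : ℕ → ℝ}
    {zhat : ∀ m, HubNull.Sample (nL m) (n m) (T m) → Fin (T m) → Fin (nL m + 1)}
    (hz : ∀ m ω, HubNull.IsMaxProfile (hn m) (HubNull.groups ω) (zhat m ω))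
    (hT : Tendsto T atTop atTop) (hd : ∀ m, 0 < d m) (hv : ∀ m, 0 < v m)
    (hsep : ∀ m, HubNull.Separated (θ m).A (d m) (v m))
    (hn_rate : Tendsto (fun m => nL m * Real.log (nL m + 1) / (d m ^ 2 * v m * n m)) atTop (𝓝 0))
    (hT_rate : Tendsto (fun m => (nL m : ℝ) ^ 2 * Real.log (T m) / (d m ^ 2 * v m * T m))
      atTop (𝓝 0))
    (hcase :
      (∃ (r : ℕ → ℝ) (c₀ : ℝ), Tendsto r atTop (𝓝 0) ∧ (∀ m i, (θ m).ρ i ≤ r m) ∧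
        (∀ m, HubNull.LeaderBound (hn m) (θ m).A (c₀ / nL m)) ∧
        Tendsto (fun m => (nL m : ℝ) ^ 2 / T m) atTop (𝓝 0)) ∨
      ∃ cmin b : ℝ, 0 < cmin ∧ (∀ m i, cmin ≤ (θ m).ρ i) ∧ b < 1 ∧
        ∀ m, HubNull.LeaderBound (hn m) (θ m).A b)
    {ε : ℝ} (hε : 0 < ε) :
    Tendsto (fun m => HubNull.sampleLaw (θ m) (T m)
      {ω | ε ≤ HubNull.errorRate (HubNull.trueLabels ω) (zhat m ω)}) atTop (𝓝 0) := by
  have hpure (η : ℝ) (hη : 0 < η) :=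
    HubNull.tendsto_sampleLaw_not_isPure hz hT hd hv hsep hn_rate hT_rate hη
  rcases hcase with ⟨r, c₀, hr, hρ, hb, hnT⟩ | ⟨cmin, b, hcmin, hρ, hb₁, hb⟩
  · exact HubNull.tendsto_errorRate_of_rare hT hpure hr hρ hb hnT hε
  · exact HubNull.tendsto_errorRate_of_frequent hT hpure hcmin hρ hb₁ hb hε

theorem theorem9 :
    -- growing number of leaders
    (∀ (nL n T : ℕ → ℕ) (hn : ∀ m, nL m ≤ n m) (θ : ∀ m, HubNull.Params (hn m))
      (d v : ℕ → ℝ) (cmin cmax c₀ : ℝ)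
      (zhat : ∀ m, HubNull.Sample (nL m) (n m) (T m) → Fin (T m) → Fin (nL m + 1)),
      (∀ m ω, HubNull.IsMaxProfile (hn m) (HubNull.groups ω) (zhat m ω)) →
      Tendsto nL atTop atTop → Tendsto n atTop atTop → Tendsto T atTop atTop →
      (∀ m, 0 < d m) → (∀ m, 0 < v m) →
      0 < cmin →
      (∀ m i, cmin / (nL m : ℝ) ≤ (θ m).ρ i ∧ (θ m).ρ i ≤ cmax / (nL m : ℝ)) →
      (∀ m, HubNull.Separated (θ m).A (d m) (v m)) →
      (∀ m, HubNull.LeaderBound (hn m) (θ m).A (c₀ / (nL m : ℝ))) →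
      Tendsto (fun m => (nL m : ℝ) ^ 2 * Real.log (nL m) / (T m : ℝ)) atTop (𝓝 0) →
      Tendsto (fun m => (nL m : ℝ) ^ 5 * Real.log (T m) / (d m ^ 2 * v m * (T m : ℝ)))
        atTop (𝓝 0) →
      Tendsto (fun m => (nL m : ℝ) ^ 8 * Real.log (nL m) / (d m ^ 4 * v m ^ 2 * (n m : ℝ)))
        atTop (𝓝 0) →
      ∀ ε : ℝ, 0 < ε →
        Tendsto (fun m => HubNull.sampleLaw (θ m) (T m)
          {ω | ε ≤ HubNull.errorRate (HubNull.trueLabels ω) (zhat m ω)}) atTop (𝓝 0)) ∧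
    -- fixed number of leaders
    (∀ (nL : ℕ) (n T : ℕ → ℕ) (hn : ∀ m, nL ≤ n m) (θ : ∀ m, HubNull.Params (hn m))
      (d v : ℕ → ℝ) (cmin b : ℝ)
      (zhat : ∀ m, HubNull.Sample nL (n m) (T m) → Fin (T m) → Fin (nL + 1)),
      (∀ m ω, HubNull.IsMaxProfile (hn m) (HubNull.groups ω) (zhat m ω)) →
      Tendsto n atTop atTop → Tendsto T atTop atTop →
      (∀ m, 0 < d m) → (∀ m, 0 < v m) →
      0 < cmin →
      (∀ m i, cmin ≤ (θ m).ρ i) →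
      (∀ m, HubNull.Separated (θ m).A (d m) (v m)) →
      b < 1 →
      (∀ m, HubNull.LeaderBound (hn m) (θ m).A b) →
      Tendsto (fun m => Real.log (T m) / (d m ^ 2 * v m * (T m : ℝ))) atTop (𝓝 0) →
      Tendsto (fun m => d m ^ 4 * v m ^ 2 * (n m : ℝ)) atTop atTop →
      ∀ ε : ℝ, 0 < ε →
        Tendsto (fun m => HubNull.sampleLaw (θ m) (T m)
          {ω | ε ≤ HubNull.errorRate (HubNull.trueLabels ω) (zhat m ω)}) atTop (𝓝 0)) := by
  constructor
  · intro nL n T hn θ d v cmin cmax c₀ zhat hz hnL _ hT hd hv _ hρ hsep hb hnT hT_rate hn_rate ε hε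
    exact theorem9_general hz hT hd hv hsep
      (HubNull.tendsto_node_rate_of_growing hnL hd hv hsep hn_rate)
      (HubNull.tendsto_group_rate_of_growing hv hT_rate)
      (.inl ⟨fun m => cmax / nL m, c₀,
        (tendsto_natCast_atTop_atTop.comp hnL).const_div_atTop cmax, fun m i => (hρ m i).2, hb,
        HubNull.tendsto_sq_div_of_growing hnL hnT⟩) hε
  · intro nL n T hn θ d v cmin b zhat hz _ hT hd hv hcmin hρ hsep hb₁ hb hT_rate hn_rate ε hε
    exact theorem9_general hz hT hd hv hsep
      (HubNull.tendsto_node_rate_of_fixed hd hv hsep hn_rate)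
      (HubNull.tendsto_group_rate_of_fixed hT_rate) (.inr ⟨cmin, b, hcmin, hρ, hb₁, hb⟩) hε
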